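/- For a prime $p$ and a positive integer $N$, let $\mathrm{AAM}(p,N)$ be the least integer $\ell\ge 0$ for which there is a set $\mathcal F\subseteq \mathbb{Z}_p^{\ell}$ with $|\mathcal F|=N$ such that for every two distinct $v,w\in\mathcal F$ and every $s\in\mathbb{Z}_p$ there is a coordinate $i$ with $v_i-w_i=s$ in $\mathbb{Z}_p$. The product dimension of a finite graph is the least number of proper vertex colorings such that any two distinct non-adjacent vertices have the same color in at least one of the colorings. **Theorem.** There are a constant $c>0$ and an integer $p_0$ such that for all primes $p>p_0$ the number $\mathrm{AAM}(p,p^p)$ is finite and $$\mathrm{AAM}(p,p^p)\;\le\; p^{\,2-\frac{c}{\log_2\log_2 p}}.$$ Consequently, with the same $c$ and $p_0$, the product dimension of the graph consisting of $p^p$ disjoint cliques of size $p$ is finite and at most $p^{\,2-\frac{c}{\log_2\log_2 p}}$. -/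

import Mathlib

/-- The pair `v, w` of vectors in `ℤ_p^ℓ` is `S`-covering: every `s ∈ S` occurs as a coordinate
difference `v i - w i`. -/
def IsCoveringPair {p ℓ : ℕ} (S : Set (ZMod p)) (v w : Fin ℓ → ZMod p) : Prop :=
  ∀ s ∈ S, ∃ i : Fin ℓ, v i - w i = s

/-- The family `F ⊆ ℤ_p^ℓ` is `S`-covering: every (ordered) pair of distinct elements is. -/
def IsCoveringFamily {p ℓ : ℕ} (S : Set (ZMod p)) (F : Finset (Fin ℓ → ZMod p)) : Prop :=
  ∀ v ∈ F, ∀ w ∈ F, v ≠ w → IsCoveringPair S v w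

/-- The Alon-Alweiss measure: the least `ℓ` such that some `ℤ_p`-covering subset of `ℤ_p^ℓ` has
exactly `N` elements (and `⊤` if there is no such `ℓ`). -/
noncomputable def AAM (p N : ℕ) : ℕ∞ :=
  sInf {x : ℕ∞ | ∃ ℓ : ℕ, x = ℓ ∧
    ∃ F : Finset (Fin ℓ → ZMod p), F.card = N ∧ IsCoveringFamily Set.univ F}

/-- The product dimension of a finite graph: the least number `k` of proper vertex colorings such
that any two distinct non-adjacent vertices have the same color in at least one of them (and `⊤`
if there is no such `k`). As the graph is finite, it is no restriction to use `ℕ` as the set of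
colors. -/
noncomputable def productDimension {V : Type*} [Finite V] (G : SimpleGraph V) : ℕ∞ :=
  sInf {x : ℕ∞ | ∃ k : ℕ, x = k ∧
    ∃ col : Fin k → G.Coloring ℕ, ∀ u v : V, u ≠ v → ¬ G.Adj u v → ∃ i, col i u = col i v}

/-- The disjoint union of `r` cliques of size `s`; the vertex `(j, i)` is vertex `i` of
clique `j`. -/
def disjointCliques (s r : ℕ) : SimpleGraph (Fin r × Fin s) where
  Adj u v := u.1 = v.1 ∧ u.2 ≠ v.2
  symm := ⟨fun _ _ h => ⟨h.1.symm, h.2.symm⟩⟩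
  loopless := ⟨fun _ h => h.2 rfl⟩

/-!
The trivial family of `p ^ p` covering vectors is `{(t * a i)_{t, i} : a ∈ ℤ_p ^ p}`, of length
about `p ^ 2`: one coordinate takes care of a single pair `(t, i)`. A coordinate can do the work
of `2 ^ m` of these, as follows.

Index the family by the subsets `A` of the box `{1, …, L} ^ m`. For every corner `i` in
`{0, …, L} ^ m` and every assignment `d` of an element of `ℤ_p` to each vertex `η` of the cube
`{0, 1} ^ m`, use the coordinate `∑ η, d η * 1_A (i + η)`. Let `A ≠ A'` and let `ε` be a vertex of
the cube. Among the points of the symmetric difference of `A` and `A'`, one that is extremal for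
the linear functional with signs `(-1) ^ ε j` is the vertex `ε` of a translate of the cube no other
vertex of which lies in the symmetric difference (`exists_cube_inter_eq_corner`). In the coordinate
of this translate, the vectors of `A` and `A'` differ by exactly `± d ε`. All `2 ^ m` values of `d`
are thus attained up to sign, and about `p / 2 ^ m` assignments and their negatives are enough for
all of `ℤ_p`. So `2 ^ (L ^ m)` vectors of length `2 * (p / 2 ^ m + 1) * (L + 1) ^ m` are obtained
(`exists_isCoveringFamily`).

For `p ^ p` vectors one needs `L ^ m` to be about `p * log p`. As long as `m ^ m ≤ p`, one has
`m < L`, so that `(L + 1) ^ m` exceeds `(L - 1) ^ m` by at most a factor `exp 2`. The choice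
`m = ⌊log p / log log p⌋` gives length `O (p ^ 2 * log p / 2 ^ m)`, where
`2 ^ m ≥ p ^ (1 / log log p) / 2`; half of the exponent absorbs the logarithm.

A covering family yields colorings of disjoint cliques: colour vertex `a` of the clique of `v` by
`a + v i`.
-/

/-! ### Cubes meeting a finite set in a prescribed vertex -/

/-- A nonempty finite subset of the box `{1, …, L} ^ m` meets, for every vertex `ε` of the cube
`{0, 1} ^ m`, some translate of the cube in its vertex `ε` only. -/
theorem exists_cube_inter_eq_corner {m L : ℕ} (D : Finset (Fin m → ℕ)) (hD : D.Nonempty)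
    (hbox : ∀ x ∈ D, ∀ j, 1 ≤ x j ∧ x j ≤ L) (ε : Fin m → Fin 2) :
    ∃ i : Fin m → Fin (L + 1), ∀ η : Fin m → Fin 2,
      (fun j => (i j : ℕ) + (η j : ℕ)) ∈ D ↔ η = ε := by
  obtain ⟨x, hx, hmax⟩ := D.exists_max_image
    (fun x => ∑ j, (1 - 2 * ((ε j : ℕ) : ℤ)) * (x j : ℤ)) hD
  have hε : ∀ j, (ε j : ℕ) ≤ x j := fun j => by
    have := (hbox x hx j).1
    have := (ε j).isLt
    omega
  refine ⟨fun j => ⟨x j - (ε j : ℕ), by have := (hbox x hx j).2; omega⟩, fun η => ⟨fun h => ?_, ?_⟩⟩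
  · -- The functional grows strictly from the vertex `ε` to any other vertex.
    by_contra hne
    obtain ⟨j₀, hj₀⟩ := Function.ne_iff.mp hne
    refine absurd (hmax _ h) (not_le.mpr (Finset.sum_lt_sum (fun j _ => ?_) ⟨j₀, by simp, ?_⟩))
    · have h1 := hε j
      have h2 := (ε j).isLt
      have h3 := (η j).isLt
      have h4 : (ε j : ℕ) = 0 ∨ (ε j : ℕ) = 1 := by omega
      rcases h4 with h4 | h4 <;> simp only [h4] at h1 ⊢ <;> push_cast [h1] <;> omega
    · have h1 := hε j₀
      have h2 := (ε j₀).isLt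
      have h3 := (η j₀).isLt
      have h5 : (η j₀ : ℕ) ≠ (ε j₀ : ℕ) := fun h => hj₀ (Fin.ext h)
      have h4 : (ε j₀ : ℕ) = 0 ∨ (ε j₀ : ℕ) = 1 := by omega
      rcases h4 with h4 | h4 <;> simp only [h4] at h1 h5 ⊢ <;> push_cast [h1] <;> omega
  · rintro rfl
    convert hx using 2 with j
    have := hε j
    simp only
    omega

/-! ### The covering family -/

/-- The coordinate of the set `A` at the translate by `i` of the cube `{0, 1} ^ m`: the sum of
the weights `d η` of those vertices `η` whose translate lies in `A`. -/
def cubeSum {R : Type*} [Ring R] {m L : ℕ} (d : (Fin m → Fin 2) → R)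
    (i : Fin m → Fin (L + 1)) (A : Finset (Fin m → ℕ)) : R :=
  ∑ η, d η * if (fun j => (i j : ℕ) + (η j : ℕ)) ∈ A then 1 else 0

theorem cubeSum_neg {R : Type*} [Ring R] {m L : ℕ} (d : (Fin m → Fin 2) → R)
    (i : Fin m → Fin (L + 1)) (A : Finset (Fin m → ℕ)) :
    cubeSum (-d) i A = -cubeSum d i A := by
  simp only [cubeSum, Pi.neg_apply, neg_mul, Finset.sum_neg_distrib]

/-- The translate of the cube does not depend on the weights, so that changing the sign of `d`
turns the second alternative into the first. -/
theorem exists_cubeSum_sub_eq {R : Type*} [Ring R] {m L : ℕ} {A A' : Finset (Fin m → ℕ)}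
    (hA : ∀ x ∈ A, ∀ j, 1 ≤ x j ∧ x j ≤ L) (hA' : ∀ x ∈ A', ∀ j, 1 ≤ x j ∧ x j ≤ L)
    (hne : A ≠ A') (d : (Fin m → Fin 2) → R) (ε : Fin m → Fin 2) :
    ∃ i : Fin m → Fin (L + 1), cubeSum d i A - cubeSum d i A' = d ε ∨
      cubeSum d i A - cubeSum d i A' = -d ε := by
  obtain ⟨i, hi⟩ := exists_cube_inter_eq_corner (L := L) (symmDiff A A')
    (Finset.nonempty_iff_ne_empty.mpr fun h => hne (symmDiff_eq_bot.mp h))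
    (fun x hx => by
      rcases Finset.mem_symmDiff.mp hx with h | h
      exacts [hA x h.1, hA' x h.1]) ε
  refine ⟨i, ?_⟩
  have hsum : cubeSum d i A - cubeSum d i A' =
      d ε * (if (fun j => (i j : ℕ) + (ε j : ℕ)) ∈ A then 1 else 0) -
        d ε * (if (fun j => (i j : ℕ) + (ε j : ℕ)) ∈ A' then 1 else 0) := by
    rw [cubeSum, cubeSum, ← Finset.sum_sub_distrib]
    refine Finset.sum_eq_single ε (fun η _ hη => ?_) (by simp)
    have h := mt (hi η).mp hη
    rw [Finset.mem_symmDiff] at h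
    by_cases h1 : (fun j => (i j : ℕ) + (η j : ℕ)) ∈ A <;>
      by_cases h2 : (fun j => (i j : ℕ) + (η j : ℕ)) ∈ A' <;> simp_all
  rcases Finset.mem_symmDiff.mp ((hi ε).mpr rfl) with h | h
  · left; rw [hsum]; simp [h.1, h.2]
  · right; rw [hsum]; simp [h.1, h.2]

theorem exists_isCoveringFamily {p m L B N : ℕ} (hp : 1 < p) (hB : p ≤ B * 2 ^ m)
    (hN : N ≤ 2 ^ L ^ m) :
    ∃ F : Finset (Fin (2 * (B * (L + 1) ^ m)) → ZMod p),
      F.card = N ∧ IsCoveringFamily Set.univ F := by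
  classical
  have : NeZero p := ⟨by omega⟩
  have : Fact (1 < p) := ⟨hp⟩
  obtain ⟨d, hd⟩ : ∃ d : Fin B × (Fin m → Fin 2) → ZMod p, Function.Surjective d := by
    obtain ⟨f⟩ := Function.Embedding.nonempty_of_card_le
      (α := ZMod p) (β := Fin B × (Fin m → Fin 2)) (by simpa [ZMod.card] using hB)
    exact ⟨Function.invFun f, Function.invFun_surjective f.injective⟩
  let e : Fin (2 * (B * (L + 1) ^ m)) ≃ Bool × Fin B × (Fin m → Fin (L + 1)) :=
    (Fintype.equivFinOfCardEq (by simp)).symm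
  let w : Bool × Fin B × (Fin m → Fin (L + 1)) → (Fin m → Fin 2) → ZMod p :=
    fun k => if k.1 then fun η => d (k.2.1, η) else -fun η => d (k.2.1, η)
  let φ : Finset (Fin m → ℕ) → Fin (2 * (B * (L + 1) ^ m)) → ZMod p :=
    fun A k => cubeSum (w (e k)) (e k).2.2 A
  let box : Finset (Fin m → ℕ) := Fintype.piFinset fun _ => Finset.Icc 1 L
  have hbox : ∀ A ∈ box.powerset, ∀ x ∈ A, ∀ j, 1 ≤ x j ∧ x j ≤ L := fun A hA x hx j =>
    Finset.mem_Icc.mp (Fintype.mem_piFinset.mp (Finset.mem_powerset.mp hA hx) j)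
  have hcov : ∀ A ∈ box.powerset, ∀ A' ∈ box.powerset, A ≠ A' → ∀ s : ZMod p,
      ∃ k, φ A k - φ A' k = s := by
    intro A hA A' hA' hne s
    obtain ⟨⟨b, ε⟩, rfl⟩ := hd s
    obtain ⟨i, h | h⟩ := exists_cubeSum_sub_eq (hbox A hA) (hbox A' hA') hne
      (fun η => d (b, η)) ε
    · exact ⟨e.symm (true, b, i), by simpa [φ, w] using h⟩
    · refine ⟨e.symm (false, b, i), ?_⟩
      simp only [φ, w, Equiv.apply_symm_apply, Bool.false_eq_true, if_false, cubeSum_neg]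
      rw [← neg_eq_iff_eq_neg] at h
      rw [← h]
      abel
  -- Sets with equal images do not realise the difference `1 ≠ 0`.
  have hinj : Set.InjOn φ (box.powerset : Finset (Finset (Fin m → ℕ))) := by
    intro A hA A' hA' h
    by_contra hne
    obtain ⟨k, hk⟩ := hcov A hA A' hA' hne 1
    rw [h, sub_self] at hk
    exact zero_ne_one hk
  have hcard : (box.powerset.image φ).card = 2 ^ L ^ m := by
    rw [Finset.card_image_of_injOn hinj, Finset.card_powerset, Fintype.card_piFinset]
    simp
  obtain ⟨F, hF, hFN⟩ := Finset.exists_subset_card_eq (hN.trans_eq hcard.symm)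
  refine ⟨F, hFN, fun v hv v' hv' hne s _ => ?_⟩
  obtain ⟨A, hA, rfl⟩ := Finset.mem_image.mp (hF hv)
  obtain ⟨A', hA', rfl⟩ := Finset.mem_image.mp (hF hv')
  exact hcov A hA A' hA' (fun h => hne (h ▸ rfl)) s

/-! ### Colorings from covering families -/

theorem exists_coloring_of_isCoveringFamily {p ℓ N : ℕ} [NeZero p]
    {F : Finset (Fin ℓ → ZMod p)} (hF : F.card = N) (hcov : IsCoveringFamily Set.univ F) :
    ∃ col : Fin ℓ → (disjointCliques p N).Coloring ℕ,
      ∀ u v, u ≠ v → ¬ (disjointCliques p N).Adj u v → ∃ i, col i u = col i v := by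
  have hcast : ∀ a b : Fin p, ((a : ℕ) : ZMod p) = ((b : ℕ) : ZMod p) → a = b := by
    intro a b h
    have h' := (ZMod.natCast_eq_natCast_iff' _ _ _).mp h
    rw [Nat.mod_eq_of_lt a.isLt, Nat.mod_eq_of_lt b.isLt] at h'
    exact Fin.ext h'
  let v : Fin N → Fin ℓ → ZMod p := fun j => (F.equivFinOfCardEq hF).symm j
  refine ⟨fun i => SimpleGraph.Coloring.mk
    (fun u => (((u.2 : ℕ) : ZMod p) + v u.1 i).val) ?_, ?_⟩
  · rintro ⟨j, a⟩ ⟨j', b⟩ ⟨hj, hab⟩ h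
    dsimp only at hj hab h
    subst hj
    exact hab (hcast a b (add_right_cancel (ZMod.val_injective p h)))
  · rintro ⟨j, a⟩ ⟨j', b⟩ hne hadj
    have hj : j ≠ j' := by
      rintro rfl
      exact hadj ⟨rfl, fun h => hne (Prod.ext rfl h)⟩
    obtain ⟨i, hi⟩ := hcov (v j) (Subtype.coe_prop _) (v j') (Subtype.coe_prop _)
      (fun h => hj ((F.equivFinOfCardEq hF).symm.injective (Subtype.ext h)))
      (((b : ℕ) : ZMod p) - ((a : ℕ) : ZMod p)) (Set.mem_univ _)
    refine ⟨i, ?_⟩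
    change (((a : ℕ) : ZMod p) + v j i).val = (((b : ℕ) : ZMod p) + v j' i).val
    congr 1
    linear_combination hi

/-! ### The choice of parameters -/

/-- The least `L` with `X ≤ L ^ m` satisfies `(L + 1) ^ m ≤ exp 2 * X`, because `m < L`. -/
theorem exists_le_pow_and_succ_pow_le {m X : ℕ} (hm : 0 < m) (hX : m ^ m < X) :
    ∃ L : ℕ, X ≤ L ^ m ∧ (L + 1) ^ m ≤ 8 * X := by
  classical
  have hex : ∃ L : ℕ, X ≤ L ^ m := ⟨X, Nat.le_self_pow hm.ne' X⟩
  obtain ⟨L, hL, hmin⟩ : ∃ L, X ≤ L ^ m ∧ ∀ K < L, K ^ m < X :=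
    ⟨Nat.find hex, Nat.find_spec hex, fun K hK => not_le.mp (Nat.find_min hex hK)⟩
  refine ⟨L, hL, ?_⟩
  have hmL : m < L := by
    by_contra h
    have := Nat.pow_le_pow_left (not_lt.mp h) m
    omega
  obtain ⟨K, rfl⟩ : ∃ K, L = K + 1 := ⟨L - 1, by omega⟩
  have hmK : (m : ℝ) ≤ K := by exact_mod_cast Nat.lt_succ_iff.mp hmL
  have hm0 : (0 : ℝ) < m := by exact_mod_cast hm
  have hK : (K : ℝ) ^ m ≤ X := by exact_mod_cast (hmin K (Nat.lt_succ_self K)).le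
  have h1 : ((K : ℝ) + 2) ≤ K * Real.exp (2 / m) := by
    have h2 := Real.add_one_le_exp (2 / (m : ℝ))
    have h3 : (2 : ℝ) ≤ K * (2 / m) := by
      rw [mul_div_assoc', le_div_iff₀ hm0]
      linarith
    nlinarith [hm0.le.trans hmK]
  have h2 : Real.exp (2 / (m : ℝ)) ^ m ≤ 8 := by
    rw [← Real.exp_nat_mul, mul_div_cancel₀ _ hm0.ne']
    have h3 := Real.exp_one_lt_d9
    have h4 : Real.exp 2 = Real.exp 1 * Real.exp 1 := by rw [← Real.exp_add]; norm_num
    rw [h4]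
    nlinarith [Real.exp_pos 1]
  have h3 : ((K : ℝ) + 2) ^ m ≤ 8 * X := by
    calc ((K : ℝ) + 2) ^ m ≤ (K * Real.exp (2 / m)) ^ m := by gcongr
      _ = Real.exp (2 / (m : ℝ)) ^ m * (K : ℝ) ^ m := by rw [mul_pow]; ring
      _ ≤ 8 * X := by gcongr
  exact_mod_cast h3

theorem two_mul_mul_le_two_rpow {y : ℝ} (hy : 10 ≤ y) : 2 * y * (y + 7) ≤ 2 ^ y := by
  have key : ∀ n : ℕ, 10 ≤ n → 2 * (n + 1) * (n + 8) ≤ 2 ^ n := by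
    intro n hn
    induction n, hn using Nat.le_induction with
    | base => norm_num
    | succ k hk ih => rw [pow_succ]; nlinarith
  have hn : 10 ≤ ⌊y⌋₊ := Nat.le_floor (by exact_mod_cast hy)
  have h1 : (2 * ((⌊y⌋₊ : ℝ) + 1) * ((⌊y⌋₊ : ℝ) + 8)) ≤ 2 ^ ⌊y⌋₊ := by exact_mod_cast key _ hn
  have h2 := Nat.lt_floor_add_one y
  calc 2 * y * (y + 7) ≤ 2 * ((⌊y⌋₊ : ℝ) + 1) * ((⌊y⌋₊ : ℝ) + 8) := by
        have h3 : y + 7 ≤ (⌊y⌋₊ : ℝ) + 8 := by linarith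
        gcongr
    _ ≤ (2 : ℝ) ^ (⌊y⌋₊ : ℝ) := by rwa [Real.rpow_natCast]
    _ ≤ 2 ^ y := Real.rpow_le_rpow_of_exponent_le (by norm_num) (Nat.floor_le (by linarith))

theorem exists_parameters {p : ℕ} (hp : 2 ^ 1024 < p) :
    ∃ m L B : ℕ, p ≤ B * 2 ^ m ∧ p ^ p ≤ 2 ^ L ^ m ∧
      ((2 * (B * (L + 1) ^ m) : ℕ) : ℝ) ≤
        (p : ℝ) ^ (2 - 1 / 2 / Real.logb 2 (Real.logb 2 (p : ℝ))) := by
  have hp0 : 0 < p := lt_of_le_of_lt (Nat.zero_le _) hp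
  have hpR : (0 : ℝ) < p := by exact_mod_cast hp0
  set x := Real.logb 2 (p : ℝ) with hx
  set y := Real.logb 2 x with hy
  have hpx : (2 : ℝ) ^ x = p := Real.rpow_logb (by norm_num) (by norm_num) hpR
  have hx1 : 1024 ≤ x := by
    rw [hx, Real.le_logb_iff_rpow_le (by norm_num) hpR]
    exact_mod_cast hp.le
  have hx0 : 0 < x := by linarith
  have hxy : (2 : ℝ) ^ y = x := Real.rpow_logb (by norm_num) (by norm_num) hx0
  have hy10 : 10 ≤ y := by
    rw [hy, Real.le_logb_iff_rpow_le (by norm_num) hx0]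
    norm_num
    exact hx1
  have hy0 : 0 < y := by linarith
  have hmain := two_mul_mul_le_two_rpow hy10
  rw [hxy] at hmain
  set m := ⌊x / y⌋₊ with hm
  have hmle : (m : ℝ) ≤ x / y := Nat.floor_le (by positivity)
  have hmlt : x / y < m + 1 := Nat.lt_floor_add_one _
  have hmy : (m : ℝ) * y ≤ x := (le_div_iff₀ hy0).mp hmle
  have hmx : (m : ℝ) ≤ x := by nlinarith [(Nat.cast_nonneg m : (0 : ℝ) ≤ m)]
  have hm0 : 0 < m := Nat.floor_pos.mpr ((one_le_div hy0).mpr (by nlinarith))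
  -- `m ^ m ≤ (log p) ^ m = 2 ^ (m * log log p) ≤ p`
  have hmm : m ^ m ≤ p := by
    have : (m : ℝ) ^ m ≤ p := by
      calc (m : ℝ) ^ m ≤ x ^ m := by gcongr
        _ = (2 : ℝ) ^ ((m : ℝ) * y) := by
          rw [mul_comm, Real.rpow_mul (by norm_num), hxy, Real.rpow_natCast]
        _ ≤ 2 ^ x := Real.rpow_le_rpow_of_exponent_le (by norm_num) hmy
        _ = p := hpx
    exact_mod_cast this
  have h2m : (2 : ℝ) ^ m ≤ p := by
    rw [← hpx, ← Real.rpow_natCast]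
    exact Real.rpow_le_rpow_of_exponent_le (by norm_num) hmx
  have hlog : (Nat.log 2 p : ℝ) ≤ x := by
    rw [hx, Real.le_logb_iff_rpow_le (by norm_num) hpR, Real.rpow_natCast]
    exact_mod_cast Nat.pow_log_le_self 2 hp0.ne'
  have hlog1 : 1 ≤ Nat.log 2 p :=
    Nat.log_pos (by norm_num) (le_trans (Nat.le_self_pow (by norm_num) 2) hp.le)
  obtain ⟨L, hL, hL'⟩ := exists_le_pow_and_succ_pow_le (X := p * (Nat.log 2 p + 1)) hm0
    (hmm.trans_lt (lt_mul_of_one_lt_right hp0 (by omega)))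
  refine ⟨m, L, p / 2 ^ m + 1, ?_, ?_, ?_⟩
  · rw [mul_comm]
    exact (Nat.lt_mul_div_succ p (by positivity)).le
  · calc p ^ p ≤ (2 ^ (Nat.log 2 p + 1)) ^ p :=
          Nat.pow_le_pow_left (Nat.lt_pow_succ_log_self (by norm_num) p).le p
      _ = 2 ^ (p * (Nat.log 2 p + 1)) := by rw [← pow_mul, mul_comm]
      _ ≤ 2 ^ L ^ m := Nat.pow_le_pow_right (by norm_num) hL
  · have h2m0 : (0 : ℝ) < 2 ^ m := by positivity
    have hB : ((p / 2 ^ m + 1 : ℕ) : ℝ) ≤ 2 * p / 2 ^ m := by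
      have h1 : ((p / 2 ^ m : ℕ) : ℝ) ≤ p / 2 ^ m := by
        simpa using (Nat.cast_div_le (α := ℝ) (m := p) (n := 2 ^ m))
      have h2 : (1 : ℝ) ≤ p / 2 ^ m := (one_le_div h2m0).mpr h2m
      push_cast
      rw [mul_div_assoc]
      linarith
    have hLR : (((L + 1) ^ m : ℕ) : ℝ) ≤ 16 * p * x := by
      calc (((L + 1) ^ m : ℕ) : ℝ) ≤ ((8 * (p * (Nat.log 2 p + 1)) : ℕ) : ℝ) := by
            exact_mod_cast hL'
        _ = 8 * p * (Nat.log 2 p + 1) := by push_cast; ring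
        _ ≤ 8 * p * (2 * x) := by gcongr; linarith
        _ = 16 * p * x := by ring
    have hpow : 128 * x * (2 : ℝ) ^ (x * (1 / 2 / y)) ≤ 2 * 2 ^ m := by
      calc 128 * x * (2 : ℝ) ^ (x * (1 / 2 / y))
          = (2 : ℝ) ^ ((7 : ℝ) + y + x * (1 / 2 / y)) := by
            rw [Real.rpow_add (by norm_num), Real.rpow_add (by norm_num), hxy]
            norm_num
        _ ≤ (2 : ℝ) ^ ((m : ℝ) + 1) := by
            refine Real.rpow_le_rpow_of_exponent_le (by norm_num) (le_trans ?_ hmlt.le)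
            rw [le_div_iff₀ hy0]
            field_simp
            linarith
        _ = 2 * 2 ^ m := by
            rw [Real.rpow_add (by norm_num), Real.rpow_natCast, Real.rpow_one, mul_comm]
    have hrhs : (p : ℝ) ^ (2 - 1 / 2 / y) = p ^ 2 / 2 ^ (x * (1 / 2 / y)) := by
      rw [Real.rpow_sub hpR, Real.rpow_mul (by norm_num), hpx]
      norm_num
    rw [hrhs, le_div_iff₀ (by positivity)]
    calc ((2 * ((p / 2 ^ m + 1) * (L + 1) ^ m) : ℕ) : ℝ) * 2 ^ (x * (1 / 2 / y))
        = 2 * (((p / 2 ^ m + 1 : ℕ) : ℝ) * (((L + 1) ^ m : ℕ) : ℝ)) * 2 ^ (x * (1 / 2 / y)) := by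
          push_cast; ring
      _ ≤ 2 * (2 * p / 2 ^ m * (16 * p * x)) * 2 ^ (x * (1 / 2 / y)) := by gcongr
      _ = p ^ 2 / 2 ^ m * (64 * x * 2 ^ (x * (1 / 2 / y))) := by ring
      _ ≤ p ^ 2 / 2 ^ m * 2 ^ m := by gcongr; linarith
      _ = p ^ 2 := by field_simp

theorem exists_sInf_eq_natCast_le {P : ℕ → Prop} {n : ℕ} (hn : P n) :
    ∃ k : ℕ, sInf {x : ℕ∞ | ∃ ℓ : ℕ, x = ℓ ∧ P ℓ} = (k : ℕ∞) ∧ k ≤ n := by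
  obtain ⟨k, hk, -⟩ := csInf_mem (s := {x : ℕ∞ | ∃ ℓ : ℕ, x = ℓ ∧ P ℓ}) ⟨n, n, rfl, hn⟩
  have hle : sInf {x : ℕ∞ | ∃ ℓ : ℕ, x = ℓ ∧ P ℓ} ≤ n := sInf_le ⟨n, rfl, hn⟩
  exact ⟨k, hk, by rw [hk] at hle; exact_mod_cast hle⟩

theorem mainTheorem2 :
    ∃ c : ℝ, 0 < c ∧ ∃ p₀ : ℕ, ∀ p : ℕ, p.Prime → p₀ < p →
      (∃ ℓ : ℕ, AAM p (p ^ p) = (ℓ : ℕ∞) ∧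
        (ℓ : ℝ) ≤ (p : ℝ) ^ (2 - c / Real.logb 2 (Real.logb 2 (p : ℝ)))) ∧
      (∃ d : ℕ, productDimension (disjointCliques p (p ^ p)) = (d : ℕ∞) ∧
        (d : ℝ) ≤ (p : ℝ) ^ (2 - c / Real.logb 2 (Real.logb 2 (p : ℝ)))) := by
  refine ⟨1 / 2, by norm_num, 2 ^ 1024, fun p hp hlt => ?_⟩
  have : NeZero p := ⟨hp.ne_zero⟩
  obtain ⟨m, L, B, hB, hN, hle⟩ := exists_parameters hlt
  obtain ⟨F, hF, hcov⟩ := exists_isCoveringFamily hp.one_lt hB hN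
  constructor
  · obtain ⟨ℓ, h1, h2⟩ := exists_sInf_eq_natCast_le
      (P := fun ℓ => ∃ F : Finset (Fin ℓ → ZMod p), F.card = p ^ p ∧
        IsCoveringFamily Set.univ F) ⟨F, hF, hcov⟩
    exact ⟨ℓ, h1, le_trans (by exact_mod_cast h2) hle⟩
  · obtain ⟨d, h1, h2⟩ := exists_sInf_eq_natCast_le
      (P := fun k => ∃ col : Fin k → (disjointCliques p (p ^ p)).Coloring ℕ,
        ∀ u v, u ≠ v → ¬ (disjointCliques p (p ^ p)).Adj u v → ∃ i, col i u = col i v)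
      (exists_coloring_of_isCoveringFamily hF hcov)
    exact ⟨d, h1, le_trans (by exact_mod_cast h2) hle⟩
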